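/- Let $\mathcal H$ be a Hilbert space over $\mathbb K=\mathbb R$ or $\mathbb K=\mathbb C$, and let $k\ge 3$. For $x_1,\dots,x_k\in\mathcal H$ put $$x_1\vee\cdots\vee x_k=\frac1{k!}\sum_{\sigma\in S_k}x_{\sigma(1)}\otimes\cdots\otimes x_{\sigma(k)},$$ the image of $x_1\otimes\cdots\otimes x_k$ under the symmetrization map of the algebraic tensor power $\bigotimes^k\mathcal H$. Let $\bigotimes^{k,s}\mathcal H\subseteq\bigotimes^k\mathcal H$ be the range of the symmetrization map, equipped with the symmetric projective tensor norm $$\pi_s(z)=\inf\Big\{\sum_{j=1}^n|c_j|\,\|y_j\|^k:\ n\ge 0,\ c_j\in\mathbb K,\ y_j\in\mathcal H,\ z=\sum_{j=1}^n c_j\,y_j\otimes\cdots\otimes y_j\Big\}.$$ If $x_1,\dots,x_k\in\mathcal H$ are vectors of norm one, then $\pi_s(x_1\vee\cdots\vee x_k)=1$ if and only if $$\dim\operatorname{span}_{\mathbb K}\{x_1,\dots,x_k\}=1\ \text{ when }\mathbb K=\mathbb C,\qquad \dim\operatorname{span}_{\mathbb K}\{x_1,\dots,x_k\}\in\{1,2\}\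 \text{ when }\mathbb K=\mathbb R.$$ -/

import Mathlib

open scoped TensorProduct Nat

noncomputable section

namespace SymTensor

variable (𝕜 : Type*) [RCLike 𝕜] (H : Type*) [NormedAddCommGroup H] [InnerProductSpace 𝕜 H]

/-- The symmetrization `x₁ ⊗ ⋯ ⊗ xₖ ↦ (1 / k!) ∑_σ x_{σ 1} ⊗ ⋯ ⊗ x_{σ k}` on the algebraic
tensor power `⨂ᵏ H`. -/
def symmetrizer (k : ℕ) :
    (⨂[𝕜] _ : Fin k, H) →ₗ[𝕜] (⨂[𝕜] _ : Fin k, H) :=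
  ((k ! : 𝕜)⁻¹) • ∑ σ : Equiv.Perm (Fin k),
    (PiTensorProduct.reindex 𝕜 (fun _ : Fin k => H) σ).toLinearMap

/-- The `k`-fold symmetric tensor product `⊗^{k,s} H`: the range of the symmetrization. -/
def symPower (k : ℕ) : Submodule 𝕜 (⨂[𝕜] _ : Fin k, H) :=
  LinearMap.range (symmetrizer 𝕜 H k)

variable {H}

/-- The symmetric tensor `x₁ ∨ ⋯ ∨ xₖ`, the symmetrization of `x₁ ⊗ ⋯ ⊗ xₖ`. -/
def symProd {k : ℕ} (x : Fin k → H) : symPower 𝕜 H k :=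
  ⟨symmetrizer 𝕜 H k (PiTensorProduct.tprod 𝕜 x), LinearMap.mem_range_self _ _⟩

theorem coe_symProd {k : ℕ} (x : Fin k → H) :
    (symProd 𝕜 x : ⨂[𝕜] _ : Fin k, H) =
      ((k ! : 𝕜)⁻¹) • ∑ σ : Equiv.Perm (Fin k), PiTensorProduct.tprod 𝕜 (fun i => x (σ i)) := by
  simp only [symProd, symmetrizer, LinearMap.smul_apply, LinearMap.sum_apply,
    LinearEquiv.coe_coe, PiTensorProduct.reindex_tprod]
  congr 1
  exact Equiv.sum_comp (Equiv.inv (Equiv.Perm (Fin k)))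
    (fun σ => PiTensorProduct.tprod 𝕜 (fun i => x (σ i)))

variable {𝕜}

/-- The symmetric projective tensor norm on `⊗^{k,s} H`:
`π_s(z) = inf { ∑ⱼ |cⱼ| ‖yⱼ‖ᵏ : z = ∑ⱼ cⱼ yⱼ ⊗ ⋯ ⊗ yⱼ }`, the infimum being over all finite
representations of `z` (they exist for every symmetric tensor, by polarization). -/
def symProjNorm {k : ℕ} (z : symPower 𝕜 H k) : ℝ :=
  sInf {r : ℝ | ∃ (n : ℕ) (c : Fin n → 𝕜) (y : Fin n → H),
    (z : ⨂[𝕜] _ : Fin k, H) = ∑ j, c j • PiTensorProduct.tprod 𝕜 (fun _ : Fin k => y j) ∧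
    r = ∑ j, ‖c j‖ * ‖y j‖ ^ k}

end SymTensor

end

/-! By Hahn–Banach, `π_s(x₁ ∨ ⋯ ∨ xₖ)` is the value at `x` of a symmetric `k`-linear form bounded by
1 on the unit diagonal. Banach's theorem (`norm_le_of_norm_diag_le`) bounds that form by 1 on all
unit tuples, so `π_s ≤ 1`, with equality only if the form attains its norm at `x`.

Suppose equality, and freeze all but three arguments: a contractive symmetric trilinear `T` has
`T(a,b,c) = 1`. By Riesz, `T` with two of these vectors inserted is the inner product with the
third. This rigidity makes `T` norming at `(u,u,c)` for `u` the normalized `a + tb`, `|t| = 1`, and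
then forces `toFun_diag`. Over `ℂ` the choices `t = 1, i` there give `|⟪u,c⟫| = 1`, so `a ± b` are
multiples of `c`. Over `ℝ`, comparing the orthonormal `a ± b` directions gives Parseval's equality
for `c`, so `c ∈ span{a,b}`.

Conversely, a contraction `f` into a normed field with `|f(xᵢ)| = 1` gives `π_s ≥ ∏ |f(xᵢ)| = 1`. On
a line `f` is an inner product; a real plane is isometric to the field `ℂ`. -/

noncomputable section

namespace SymTensor

/-! ### Banach's theorem on symmetric multilinear forms -/

section Banach

variable {𝕜 : Type*} [RCLike 𝕜] {E : Type*} [NormedAddCommGroup E] [InnerProductSpace 𝕜 E]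
  {ι : Type*}

theorem comp_swap_update_update [DecidableEq ι] {α : Type*} {x : ι → α} {i j : ι} (hij : i ≠ j) (a b : α) :
    (Function.update (Function.update x i a) j b) ∘ Equiv.swap i j =
      Function.update (Function.update x i b) j a := by
  funext l
  rcases eq_or_ne l i with rfl | hi
  · simp [Function.update_of_ne hij]
  · rcases eq_or_ne l j with rfl | hj
    · simp [Function.update_of_ne hij]
    · simp [Equiv.swap_apply_of_ne_of_ne hi hj, hi, hj]

theorem continuous_of_finiteDimensional [Fintype ι] [FiniteDimensional 𝕜 E]
    (f : MultilinearMap 𝕜 (fun _ : ι => E) 𝕜) : Continuous f := by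
  classical
  let b := Module.finBasis 𝕜 E
  have h : (f : (ι → E) → 𝕜) = fun x => ∑ r : ι → Fin (Module.finrank 𝕜 E),
      (∏ i, b.coord (r i) (x i)) * f (fun i => b (r i)) := by
    funext x
    have hx : x = fun i => ∑ j, b.coord j (x i) • b j := by
      funext i
      exact (b.sum_repr (x i)).symm
    conv_lhs => rw [hx, MultilinearMap.map_sum]
    simp only [MultilinearMap.map_smul_univ, smul_eq_mul]
  rw [h]
  refine continuous_finsetSum _ fun r _ => Continuous.mul ?_ continuous_const
  exact continuous_finsetProd _ fun i _ =>
    (LinearMap.continuous_of_finiteDimensional (b.coord (r i))).comp (continuous_apply i)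

/-- A multilinear form is bounded by its values on unit vectors. -/
theorem norm_le_prod_of_unit [Fintype ι] {f : MultilinearMap 𝕜 (fun _ : ι => E) 𝕜} {M : ℝ} (hM : 0 ≤ M)
    (hf : ∀ x : ι → E, (∀ i, ‖x i‖ = 1) → ‖f x‖ ≤ M) (x : ι → E) :
    ‖f x‖ ≤ M * ∏ i, ‖x i‖ := by
  by_cases h0 : ∃ i, x i = 0
  · obtain ⟨i, hi⟩ := h0
    rw [f.map_coord_zero i hi, norm_zero]
    positivity
  · push Not at h0
    have hx : x = fun i => (‖x i‖ : 𝕜) • ((‖x i‖ : 𝕜)⁻¹ • x i) := by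
      funext i
      rw [smul_smul, mul_inv_cancel₀ (by simpa using h0 i), one_smul]
    have h1 := hf (fun i => (‖x i‖ : 𝕜)⁻¹ • x i) fun i => by
      simp [norm_smul, h0 i]
    conv_lhs => rw [hx, MultilinearMap.map_smul_univ, norm_smul, norm_prod]
    simp only [RCLike.norm_ofReal, abs_norm]
    rw [mul_comm]
    gcongr

variable [Fintype ι] [DecidableEq ι]

/-- A maximal pair of vectors in two slots of a symmetric form can be replaced by its sum. -/
theorem norm_update_add_ge {f : MultilinearMap 𝕜 (fun _ : ι => E) 𝕜}
    (hsymm : ∀ (x : ι → E) (σ : Equiv.Perm ι), f (x ∘ σ) = f x) {x : ι → E}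
    (hx : ∀ i, ‖x i‖ = 1) (hmax : ∀ y : ι → E, (∀ i, ‖y i‖ = 1) → ‖f y‖ ≤ ‖f x‖)
    {i j : ι} (hij : i ≠ j) :
    ‖f x‖ * ‖x i + x j‖ ^ 2 ≤
      ‖f (Function.update (Function.update x i (x i + x j)) j (x i + x j))‖ := by
  set g : E → E → 𝕜 := fun a b => f (Function.update (Function.update x i a) j b) with hg
  have hadd2 : ∀ a b c, g a (b + c) = g a b + g a c := fun a b c => f.map_update_add _ _ _ _
  have hsub2 : ∀ a b c, g a (b - c) = g a b - g a c := fun a b c => f.map_update_sub _ _ _ _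
  have hcomm : ∀ a b, g a b = g b a := fun a b => by
    simp only [hg]
    rw [← hsymm _ (Equiv.swap i j), comp_swap_update_update hij]
  have hadd1 : ∀ a b c, g (a + b) c = g a c + g b c := fun a b c => by
    rw [hcomm, hadd2, hcomm c a, hcomm c b]
  have hsub1 : ∀ a b c, g (a - b) c = g a c - g b c := fun a b c => by
    rw [hcomm, hsub2, hcomm c a, hcomm c b]
  have hxg : g (x i) (x j) = f x := by simp [hg]
  have hbound := norm_le_prod_of_unit (norm_nonneg (f x)) hmax
  have hprod : ∀ a b, ∏ l, ‖Function.update (Function.update x i a) j b l‖ = ‖a‖ * ‖b‖ := by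
    intro a b
    rw [Fintype.prod_eq_mul i j hij]
    · simp [Function.update_of_ne hij]
    · rintro l ⟨hi, hj⟩
      simp [hi, hj, hx]
  have hd : ‖g (x i - x j) (x i - x j)‖ ≤ ‖f x‖ * ‖x i - x j‖ ^ 2 := by
    have := hbound (Function.update (Function.update x i (x i - x j)) j (x i - x j))
    rwa [hprod, ← sq] at this
  -- Polarization: maximality bounds the difference term by `‖f x‖ * ‖x i - x j‖ ^ 2`, and the
  -- parallelogram law turns what is left into `‖f x‖ * ‖x i + x j‖ ^ 2`.
  have hpol : 4 * f x = g (x i + x j) (x i + x j) - g (x i - x j) (x i - x j) := by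
    rw [hadd1, hadd2, hadd2, hsub1, hsub2, hsub2, hcomm (x j) (x i), hxg]
    ring
  have hpar := parallelogram_law_with_norm 𝕜 (x i) (x j)
  rw [hx, hx] at hpar
  have h4 : 4 * ‖f x‖ ≤ ‖g (x i + x j) (x i + x j)‖ + ‖g (x i - x j) (x i - x j)‖ := by
    have := norm_sub_le (g (x i + x j) (x i + x j)) (g (x i - x j) (x i - x j))
    rw [← hpol, norm_mul] at this
    simpa using this
  have : ‖x i - x j‖ ^ 2 = 4 - ‖x i + x j‖ ^ 2 := by nlinarith
  rw [this] at hd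
  change _ ≤ ‖g (x i + x j) (x i + x j)‖
  nlinarith

/-- Among the unit tuples maximizing `‖f‖`, compactness gives one with the longest sum `S`. If two
entries differed, replacing both by their normalized sum would keep `‖f‖` maximal and lengthen `S`;
so the tuple is constant. -/
theorem norm_le_of_norm_diag_le_of_finiteDimensional [FiniteDimensional 𝕜 E]
    {f : MultilinearMap 𝕜 (fun _ : ι => E) 𝕜}
    (hsymm : ∀ (x : ι → E) (σ : Equiv.Perm ι), f (x ∘ σ) = f x) {M : ℝ}
    (hdiag : ∀ y : E, ‖y‖ = 1 → ‖f fun _ => y‖ ≤ M) {x₀ : ι → E} (hx₀ : ∀ i, ‖x₀ i‖ = 1)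
    [Nonempty ι] :
    ‖f x₀‖ ≤ M := by
  have hprop : ProperSpace E := FiniteDimensional.proper_rclike 𝕜 E
  have hcont := continuous_of_finiteDimensional f
  set K : Set (ι → E) := Set.univ.pi fun _ => Metric.sphere (0 : E) 1 with hKdef
  have hK : IsCompact K := isCompact_univ_pi fun _ => isCompact_sphere _ _
  have hmem : ∀ x, x ∈ K ↔ ∀ i, ‖x i‖ = 1 := fun x => by simp [hKdef]
  obtain ⟨z, hzK, hz⟩ := hK.exists_isMaxOn ⟨x₀, (hmem _).2 hx₀⟩ hcont.norm.continuousOn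
  have hK' : IsCompact (K ∩ {x | ‖f x‖ = ‖f z‖}) :=
    hK.inter_right (isClosed_eq hcont.norm continuous_const)
  obtain ⟨x, ⟨hxK, hxz⟩, hx⟩ := hK'.exists_isMaxOn ⟨z, hzK, rfl⟩
    (f := fun x => ‖∑ i, x i‖) (by fun_prop)
  have hxz : ‖f x‖ = ‖f z‖ := hxz
  have hmax : ∀ y : ι → E, (∀ i, ‖y i‖ = 1) → ‖f y‖ ≤ ‖f x‖ := fun y hy =>
    hxz ▸ hz ((hmem y).2 hy)
  have hsum : ∀ y : ι → E, (∀ i, ‖y i‖ = 1) → ‖f x‖ ≤ ‖f y‖ → ‖∑ i, y i‖ ≤ ‖∑ i, x i‖ :=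
    fun y hy h => hx ⟨(hmem y).2 hy, (le_antisymm (hmax y hy) h).trans hxz⟩
  have hx1 : ∀ i, ‖x i‖ = 1 := (hmem x).1 hxK
  set S := ∑ i, x i with hS
  -- Changing the sign of `x i` preserves `‖f x‖`, so `S - 2 x i` is no longer than `S`.
  have hflip : ∀ i, 1 ≤ RCLike.re (inner 𝕜 S (x i)) := by
    intro i
    have h1 := hsum (Function.update x i (-x i))
      (fun l => by rcases eq_or_ne l i with rfl | h <;> simp [*])
      (by rw [← neg_one_smul 𝕜 (x i), f.map_update_smul]; simp)
    have h2 : ∑ l, Function.update x i (-x i) l = S - (2 : 𝕜) • x i := by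
      rw [hS, ← Finset.add_sum_erase _ _ (Finset.mem_univ i),
        ← Finset.add_sum_erase _ x (Finset.mem_univ i), Function.update_self,
        Finset.sum_congr rfl fun l hl => Function.update_of_ne (Finset.ne_of_mem_erase hl) _ _,
        two_smul]
      abel
    rw [h2] at h1
    have h3 := norm_sub_sq (𝕜 := 𝕜) S ((2 : 𝕜) • x i)
    rw [inner_smul_right, norm_smul, hx1] at h3
    have h4 : RCLike.re ((2 : 𝕜) * inner 𝕜 S (x i)) = 2 * RCLike.re (inner 𝕜 S (x i)) := by
      simp [RCLike.mul_re]
    have h5 : ‖S - (2 : 𝕜) • x i‖ ^ 2 ≤ ‖S‖ ^ 2 := by gcongr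
    rw [h3, h4, RCLike.norm_two] at h5
    linarith
  have heq : ∀ i j, x i = x j := by
    intro i j
    by_contra hne
    have hij : i ≠ j := fun h => hne (h ▸ rfl)
    set s := x i + x j with hs
    have hSs : 2 ≤ RCLike.re (inner 𝕜 S s) := by
      rw [hs, inner_add_right, map_add]
      linarith [hflip i, hflip j]
    have hs0 : 0 < ‖s‖ := by
      rw [norm_pos_iff]
      rintro h
      rw [h] at hSs
      simp at hSs
      linarith
    set u : E := ((‖s‖ : 𝕜)⁻¹) • s with hu
    have hu1 : ‖u‖ = 1 := by
      rw [hu, norm_smul]; simp [hs0.ne']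
    have hval : ‖f x‖ ≤ ‖f (Function.update (Function.update x i u) j u)‖ := by
      have h1 := norm_update_add_ge hsymm hx1 hmax hij
      rw [← hs] at h1
      rw [hu, f.map_update_smul, Function.update_comm hij, f.map_update_smul,
        Function.update_comm hij.symm, norm_smul, norm_smul]
      simp only [norm_inv, RCLike.norm_ofReal, abs_norm]
      rw [← mul_assoc, ← mul_inv, ← sq, ← div_eq_inv_mul, le_div_iff₀ (by positivity)]
      exact h1
    have h1 := hsum _ (fun l => by
      rcases eq_or_ne l j with rfl | h
      · simp [hu1]
      · rcases eq_or_ne l i with rfl | h'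
        · rw [Function.update_of_ne h, Function.update_self, hu1]
        · rw [Function.update_of_ne h, Function.update_of_ne h', hx1]) hval
    have h2 : ∑ l, Function.update (Function.update x i u) j u l
        = S + ((2 * ‖s‖⁻¹ - 1 : ℝ) : 𝕜) • s := by
      have e1 : ∀ l, Function.update (Function.update x i u) j u l =
          x l + ((if l = i then u - x i else 0) + if l = j then u - x j else 0) := by
        intro l
        rcases eq_or_ne l j with rfl | h
        · simp [hij.symm]
        · rcases eq_or_ne l i with rfl | h' <;> simp [*]
      simp only [e1, Finset.sum_add_distrib, Finset.sum_ite_eq', Finset.mem_univ, if_true]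
      have e2 : ((2 * ‖s‖⁻¹ - 1 : ℝ) : 𝕜) • s = u + u - (x i + x j) := by
        push_cast
        rw [sub_smul, two_mul, add_smul, one_smul]
      rw [← hS, e2]
      abel
    rw [h2] at h1
    have h3 := norm_add_sq (𝕜 := 𝕜) S (((2 * ‖s‖⁻¹ - 1 : ℝ) : 𝕜) • s)
    rw [inner_smul_right, norm_smul, RCLike.re_ofReal_mul, RCLike.norm_ofReal] at h3
    have h5 : ‖S + ((2 * ‖s‖⁻¹ - 1 : ℝ) : 𝕜) • s‖ ^ 2 ≤ ‖S‖ ^ 2 := by gcongr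
    have hpar := parallelogram_law_with_norm 𝕜 (x i) (x j)
    rw [hx1, hx1, ← hs] at hpar
    have hd : 0 < ‖x i - x j‖ := norm_pos_iff.2 (sub_ne_zero.2 hne)
    -- Distinct unit vectors have `‖s‖ < 2`, so `S` grows by a positive multiple of `s`, with which
    -- it has positive real inner product.
    have ht : 0 < 2 * ‖s‖⁻¹ - 1 := by
      have : ‖s‖ < 2 := by nlinarith
      rw [← div_eq_mul_inv, sub_pos, lt_div_iff₀ hs0]
      linarith
    have := mul_pos ht (by linarith : 0 < RCLike.re (inner 𝕜 S s))
    nlinarith [sq_nonneg (|2 * ‖s‖⁻¹ - 1| * ‖s‖)]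
  let i₀ : ι := Classical.arbitrary ι
  have hconst : x = fun _ => x i₀ := funext fun i => heq i i₀
  calc ‖f x₀‖ ≤ ‖f x‖ := hmax _ hx₀
    _ ≤ M := by
      rw [hconst]
      exact hdiag _ (hx1 _)

/-- **Banach's theorem**: the norm of a symmetric multilinear form on an inner product space is
attained on the diagonal. -/
theorem norm_le_of_norm_diag_le [Nonempty ι]
    {f : MultilinearMap 𝕜 (fun _ : ι => E) 𝕜}
    (hsymm : ∀ (x : ι → E) (σ : Equiv.Perm ι), f (x ∘ σ) = f x) {M : ℝ}
    (hdiag : ∀ y : E, ‖y‖ = 1 → ‖f fun _ => y‖ ≤ M) {x : ι → E} (hx : ∀ i, ‖x i‖ = 1) :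
    ‖f x‖ ≤ M := by
  -- Restricting to the span of the arguments supplies the compactness.
  let V := Submodule.span 𝕜 (Set.range x)
  have : FiniteDimensional 𝕜 V := FiniteDimensional.span_of_finite 𝕜 (Set.finite_range x)
  exact norm_le_of_norm_diag_le_of_finiteDimensional
    (f := f.compLinearMap fun _ => V.subtype) (fun y σ => hsymm (fun i => (y i : E)) σ)
    (fun y hy => hdiag y hy)
    (x₀ := fun i => ⟨x i, Submodule.subset_span (Set.mem_range_self i)⟩) hx

theorem norm_le_prod_of_norm_diag_le [Nonempty ι]
    {f : MultilinearMap 𝕜 (fun _ : ι => E) 𝕜}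
    (hsymm : ∀ (x : ι → E) (σ : Equiv.Perm ι), f (x ∘ σ) = f x) {M : ℝ} (hM : 0 ≤ M)
    (hdiag : ∀ y : E, ‖y‖ = 1 → ‖f fun _ => y‖ ≤ M) (x : ι → E) :
    ‖f x‖ ≤ M * ∏ i, ‖x i‖ :=
  norm_le_prod_of_unit hM (fun _ hx => norm_le_of_norm_diag_le hsymm hdiag hx) x

end Banach

end SymTensor

end

noncomputable section

namespace SymTensor

/-! ### Duality for the symmetric projective norm -/

section ProjectiveNorm

variable {𝕜 : Type*} [RCLike 𝕜] {H : Type*} [NormedAddCommGroup H] [InnerProductSpace 𝕜 H] {k : ℕ}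

theorem symProd_comp_perm (x : Fin k → H) (σ : Equiv.Perm (Fin k)) :
    symProd 𝕜 (x ∘ σ) = symProd 𝕜 x := by
  apply Subtype.ext
  rw [coe_symProd, coe_symProd]
  congr 1
  exact Equiv.sum_comp (Equiv.mulLeft σ)
    (fun τ => PiTensorProduct.tprod 𝕜 (fun i => x (τ i)))

theorem coe_symProd_const (y : H) :
    (symProd 𝕜 (fun _ : Fin k => y) : ⨂[𝕜] _ : Fin k, H) =
      PiTensorProduct.tprod 𝕜 (fun _ : Fin k => y) := by
  rw [coe_symProd, Finset.sum_const, Finset.card_univ, Fintype.card_perm, Fintype.card_fin,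
    ← Nat.cast_smul_eq_nsmul 𝕜, smul_smul,
    inv_mul_cancel₀ (Nat.cast_ne_zero.2 (Nat.factorial_ne_zero k)), one_smul]

/-- The symmetric multilinear form associated with a linear form on the symmetric power. -/
def symForm (ξ : symPower 𝕜 H k →ₗ[𝕜] 𝕜) : MultilinearMap 𝕜 (fun _ : Fin k => H) 𝕜 :=
  (ξ ∘ₗ (symmetrizer 𝕜 H k).rangeRestrict).compMultilinearMap (PiTensorProduct.tprod 𝕜)

theorem symForm_apply (ξ : symPower 𝕜 H k →ₗ[𝕜] 𝕜) (x : Fin k → H) :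
    symForm ξ x = ξ (symProd 𝕜 x) := rfl

theorem symForm_comp_perm (ξ : symPower 𝕜 H k →ₗ[𝕜] 𝕜) (x : Fin k → H)
    (σ : Equiv.Perm (Fin k)) : symForm ξ (x ∘ σ) = symForm ξ x := by
  rw [symForm_apply, symForm_apply, symProd_comp_perm]

theorem span_range_symProd :
    Submodule.span 𝕜 (Set.range fun x : Fin k → H => symProd 𝕜 x) = ⊤ := by
  have h := congrArg (Submodule.map (symmetrizer 𝕜 H k).rangeRestrict)
    (PiTensorProduct.span_tprod_eq_top (R := 𝕜) (s := fun _ : Fin k => H))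
  rw [Submodule.map_span, Submodule.map_top, LinearMap.range_rangeRestrict, ← Set.range_comp] at h
  exact h

/-- Banach's theorem with bound 0 replaces the polarization formula: a linear form vanishing on all
powers vanishes on every symmetric product. -/
theorem span_range_symProd_const (hk : k ≠ 0) :
    Submodule.span 𝕜 (Set.range fun y : H => symProd 𝕜 (fun _ : Fin k => y)) = ⊤ := by
  have : Nonempty (Fin k) := ⟨⟨0, Nat.pos_of_ne_zero hk⟩⟩
  rw [eq_top_iff, ← span_range_symProd, Submodule.span_le]
  rintro _ ⟨x, rfl⟩
  by_contra hx
  obtain ⟨ξ, hξx, hξ⟩ := Submodule.exists_le_ker_of_notMem hx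
  have := norm_le_prod_of_norm_diag_le (f := symForm ξ) (symForm_comp_perm ξ) le_rfl
    (fun y _ => by
      rw [symForm_apply, LinearMap.mem_ker.1 (hξ (Submodule.subset_span ⟨y, rfl⟩)), norm_zero]) x
  rw [zero_mul] at this
  exact hξx (norm_le_zero_iff.1 this)

/-- The costs of the representations of `z` as a combination of powers. -/
def symReprCosts (z : symPower 𝕜 H k) : Set ℝ :=
  {r : ℝ | ∃ (n : ℕ) (c : Fin n → 𝕜) (y : Fin n → H),
    (z : ⨂[𝕜] _ : Fin k, H) = ∑ j, c j • PiTensorProduct.tprod 𝕜 (fun _ : Fin k => y j) ∧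
    r = ∑ j, ‖c j‖ * ‖y j‖ ^ k}

theorem symProjNorm_eq (z : symPower 𝕜 H k) : symProjNorm z = sInf (symReprCosts z) := rfl

theorem symReprCosts_bddBelow (z : symPower 𝕜 H k) : BddBelow (symReprCosts z) := by
  refine ⟨0, ?_⟩
  rintro _ ⟨n, c, y, -, rfl⟩
  positivity

/-- This rules out the default value `sInf ∅ = 0`, so lower bounds on costs pass to `symProjNorm`.
-/
theorem symReprCosts_nonempty (hk : k ≠ 0) (z : symPower 𝕜 H k) : (symReprCosts z).Nonempty := by
  have hz : z ∈ Submodule.span 𝕜 (Set.range fun y : H => symProd 𝕜 (fun _ : Fin k => y)) := by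
    rw [span_range_symProd_const hk]
    trivial
  obtain ⟨n, c, g, rfl⟩ := Submodule.mem_span_set'.1 hz
  choose y hy using fun j => (g j).2
  refine ⟨_, n, c, y, ?_, rfl⟩
  rw [Submodule.coe_sum]
  refine Finset.sum_congr rfl fun j _ => ?_
  rw [Submodule.coe_smul, ← hy, coe_symProd_const]

theorem symProjNorm_le {z : symPower 𝕜 H k} {r : ℝ} (h : r ∈ symReprCosts z) :
    symProjNorm z ≤ r :=
  csInf_le (symReprCosts_bddBelow z) h

theorem symProjNorm_const_le (y : H) :
    symProjNorm (symProd 𝕜 (fun _ : Fin k => y)) ≤ ‖y‖ ^ k :=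
  symProjNorm_le ⟨1, fun _ => 1, fun _ => y, by simp [coe_symProd_const], by simp⟩

theorem symReprCosts_add {z w : symPower 𝕜 H k} {r s : ℝ} (hr : r ∈ symReprCosts z)
    (hs : s ∈ symReprCosts w) : r + s ∈ symReprCosts (z + w) := by
  obtain ⟨n, c, y, hz, rfl⟩ := hr
  obtain ⟨m, d, v, hw, rfl⟩ := hs
  refine ⟨n + m, Fin.append c d, Fin.append y v, ?_, ?_⟩
  · simp [Fin.sum_univ_add, hz, hw]
  · simp [Fin.sum_univ_add]

theorem symReprCosts_smul {z : symPower 𝕜 H k} {r : ℝ} (a : 𝕜) (hr : r ∈ symReprCosts z) :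
    ‖a‖ * r ∈ symReprCosts (a • z) := by
  obtain ⟨n, c, y, hz, rfl⟩ := hr
  refine ⟨n, fun j => a * c j, y, ?_, ?_⟩
  · simp [hz, Finset.smul_sum, smul_smul]
  · simp [Finset.mul_sum, mul_assoc]

/-- The symmetric projective tensor norm as a seminorm. -/
def symProjSeminorm (hk : k ≠ 0) : Seminorm 𝕜 (symPower 𝕜 H k) :=
  Seminorm.ofSMulLE symProjNorm
    (le_antisymm (symProjNorm_le ⟨0, Fin.elim0, Fin.elim0, by simp, by simp⟩)
      (Real.sInf_nonneg (by rintro _ ⟨n, c, y, -, rfl⟩; positivity)))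
    (fun z w => by
      refine le_of_forall_pos_lt_add fun ε hε => ?_
      obtain ⟨r, hr, hr'⟩ := Real.lt_sInf_add_pos (symReprCosts_nonempty hk z) (half_pos hε)
      obtain ⟨s, hs, hs'⟩ := Real.lt_sInf_add_pos (symReprCosts_nonempty hk w) (half_pos hε)
      have := symProjNorm_le (symReprCosts_add hr hs)
      rw [← symProjNorm_eq] at hr' hs'
      linarith)
    (fun a z => by
      rw [symProjNorm_eq z, ← smul_eq_mul, ← Real.sInf_smul_of_nonneg (norm_nonneg a)]
      refine le_csInf (symReprCosts_nonempty hk z).smul_set ?_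
      rintro _ ⟨r, hr, rfl⟩
      exact symProjNorm_le (symReprCosts_smul a hr))

/-- Hahn–Banach extension of `c • z ↦ c * p z` from the line through `z`. -/
theorem exists_dual_seminorm {V : Type*} [AddCommGroup V] [Module 𝕜 V] (p : Seminorm 𝕜 V) (z : V) :
    ∃ ξ : V →ₗ[𝕜] 𝕜, ξ z = (p z : 𝕜) ∧ ∀ w, ‖ξ w‖ ≤ p w := by
  by_cases hz : z = 0
  · subst hz
    exact ⟨0, by simp, fun w => by simp⟩
  · let e := LinearEquiv.toSpanNonzeroSingleton 𝕜 V z hz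
    obtain ⟨g, hg, hgp⟩ := Module.Dual.exists_extension_of_le_seminorm (𝕜 := 𝕜)
      (Submodule.span 𝕜 {z}) ((p z : 𝕜) • e.symm.toLinearMap) (p := p) (by
        intro w
        obtain ⟨c, rfl⟩ := e.surjective w
        have he : ((e c : Submodule.span 𝕜 {z}) : V) = c • z := rfl
        rw [LinearMap.smul_apply, LinearEquiv.coe_coe, e.symm_apply_apply, he, map_smul_eq_mul,
          norm_smul, RCLike.norm_ofReal, abs_of_nonneg (apply_nonneg p z), mul_comm])
    refine ⟨g, ?_, hgp⟩
    have h := hg (e 1)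
    have he : ((e 1 : Submodule.span 𝕜 {z}) : V) = z := one_smul 𝕜 z
    rwa [LinearMap.smul_apply, LinearEquiv.coe_coe, e.symm_apply_apply, he, smul_eq_mul,
      mul_one] at h

/-- A norming form for `π_s` and the bound on its polarization. -/
theorem exists_norming_form (hk : k ≠ 0) (z : symPower 𝕜 H k) :
    ∃ ξ : symPower 𝕜 H k →ₗ[𝕜] 𝕜, ξ z = (symProjNorm z : 𝕜) ∧
      ∀ x : Fin k → H, ‖symForm ξ x‖ ≤ ∏ i, ‖x i‖ := by
  have : Nonempty (Fin k) := ⟨⟨0, Nat.pos_of_ne_zero hk⟩⟩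
  obtain ⟨ξ, hξz, hξ⟩ := exists_dual_seminorm (symProjSeminorm hk) z
  refine ⟨ξ, hξz, fun x => ?_⟩
  have := norm_le_prod_of_norm_diag_le (f := symForm ξ) (symForm_comp_perm ξ) zero_le_one
    (fun y hy => (hξ _).trans ((symProjNorm_const_le y).trans (by rw [hy, one_pow]))) x
  rwa [one_mul] at this

theorem symProjNorm_nonneg (z : symPower 𝕜 H k) : 0 ≤ symProjNorm z :=
  Real.sInf_nonneg (by rintro _ ⟨n, c, y, -, rfl⟩; positivity)

theorem symProjNorm_symProd_le (hk : k ≠ 0) (x : Fin k → H) :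
    symProjNorm (symProd 𝕜 x) ≤ ∏ i, ‖x i‖ := by
  obtain ⟨ξ, hξz, hξ⟩ := exists_norming_form hk (symProd 𝕜 x)
  have := hξ x
  rwa [symForm_apply, hξz, RCLike.norm_ofReal, abs_of_nonneg (symProjNorm_nonneg _)] at this

/-- Lower bound on `π_s` from a contractive linear map into a commutative normed division algebra:
its `k`-th power is a polynomial of norm at most one. -/
theorem prod_norm_le_symProjNorm (hk : k ≠ 0) {A : Type*} [NormedField A] [NormedAlgebra 𝕜 A]
    (f : H →ₗ[𝕜] A) (hf : ∀ y, ‖f y‖ ≤ ‖y‖) (x : Fin k → H) :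
    ∏ i, ‖f (x i)‖ ≤ symProjNorm (symProd 𝕜 x) := by
  let F : (⨂[𝕜] _ : Fin k, H) →ₗ[𝕜] A := PiTensorProduct.lift
    ((MultilinearMap.mkPiAlgebra 𝕜 (Fin k) A).compLinearMap fun _ => f)
  have hF : ∀ y : Fin k → H, F (PiTensorProduct.tprod 𝕜 y) = ∏ i, f (y i) := fun y => by simp [F]
  have hFx : F (symProd 𝕜 x) = ∏ i, f (x i) := by
    rw [coe_symProd, map_smul, map_sum]
    have : ∀ σ : Equiv.Perm (Fin k), F (PiTensorProduct.tprod 𝕜 fun i => x (σ i)) =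
        ∏ i, f (x i) := fun σ => by rw [hF]; exact Equiv.prod_comp σ fun i => f (x i)
    rw [Finset.sum_congr rfl fun σ _ => this σ, Finset.sum_const, Finset.card_univ,
      Fintype.card_perm, Fintype.card_fin, ← Nat.cast_smul_eq_nsmul 𝕜, smul_smul,
      inv_mul_cancel₀ (Nat.cast_ne_zero.2 (Nat.factorial_ne_zero k)), one_smul]
  refine le_csInf (symReprCosts_nonempty hk _) ?_
  rintro _ ⟨n, c, y, hz, rfl⟩
  rw [← norm_prod, ← hFx, hz, map_sum]
  refine (norm_sum_le _ _).trans (Finset.sum_le_sum fun j _ => ?_)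
  rw [map_smul, hF, norm_smul, Finset.prod_const, Finset.card_univ, Fintype.card_fin, norm_pow]
  gcongr
  exact hf _

theorem symProjNorm_symProd_eq_one (hk : k ≠ 0) {A : Type*} [NormedField A] [NormedAlgebra 𝕜 A]
    (f : H →ₗ[𝕜] A) (hf : ∀ y, ‖f y‖ ≤ ‖y‖) {x : Fin k → H} (hx : ∀ i, ‖x i‖ = 1)
    (hfx : ∀ i, ‖f (x i)‖ = 1) : symProjNorm (symProd 𝕜 x) = 1 := by
  apply le_antisymm
  · simpa [hx] using symProjNorm_symProd_le hk x
  · simpa [hfx] using prod_norm_le_symProjNorm hk f hf x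

end ProjectiveNorm

end SymTensor

end

noncomputable section

namespace SymTensor

/-! ### Rigidity of norming symmetric trilinear forms -/

section Trilinear

variable {𝕜 : Type*} [RCLike 𝕜] {H : Type*} [NormedAddCommGroup H] [InnerProductSpace 𝕜 H]

/-- A linear form attaining its norm at a unit vector `c` is a multiple of `⟪c, ·⟫`. -/
theorem eq_mul_inner_of_norm_le [CompleteSpace H] (g : H →ₗ[𝕜] 𝕜) {c : H} (hc : ‖c‖ = 1)
    (hg : ∀ z, ‖g z‖ ≤ ‖g c‖ * ‖z‖) (z : H) : g z = g c * inner 𝕜 c z := by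
  let G : StrongDual 𝕜 H := g.mkContinuous ‖g c‖ hg
  let r := (InnerProductSpace.toDual 𝕜 H).symm G
  have hr : ∀ z, inner 𝕜 r z = g z := fun z => InnerProductSpace.toDual_symm_apply
  have hrn : ‖r‖ ≤ ‖g c‖ := by
    rw [LinearIsometryEquiv.norm_map]
    exact LinearMap.mkContinuous_norm_le _ (norm_nonneg _) hg
  -- Equality in Cauchy–Schwarz: the squared distance expands to `‖r‖ ^ 2 - ‖g c‖ ^ 2 ≤ 0`.
  have h0 : r = (starRingEnd 𝕜 (g c)) • c := by
    rw [← sub_eq_zero, ← norm_eq_zero, ← sq_eq_zero_iff]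
    refine le_antisymm ?_ (sq_nonneg _)
    rw [norm_sub_sq (𝕜 := 𝕜), inner_smul_right, hr, norm_smul, RCLike.norm_conj, hc,
      RCLike.conj_mul, ← RCLike.ofReal_pow, RCLike.ofReal_re]
    have : ‖r‖ ^ 2 ≤ ‖g c‖ ^ 2 := by gcongr
    linarith
  rw [← hr z, h0, inner_smul_left, RCLike.conj_conj]

variable (𝕜 H) in
/-- Symmetric trilinear forms of norm at most one. -/
structure SymmTrilinear where
  toFun : H → H → H → 𝕜
  map_add : ∀ a b c c', toFun a b (c + c') = toFun a b c + toFun a b c'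
  map_smul : ∀ a b (t : 𝕜) c, toFun a b (t • c) = t * toFun a b c
  swap₁ : ∀ a b c, toFun a b c = toFun b a c
  swap₂ : ∀ a b c, toFun a b c = toFun a c b
  bound : ∀ a b c, ‖toFun a b c‖ ≤ ‖a‖ * ‖b‖ * ‖c‖

namespace SymmTrilinear

variable (T : SymmTrilinear 𝕜 H)

theorem map_smul₁ (t : 𝕜) (a b c : H) : T.toFun (t • a) b c = t * T.toFun a b c := by
  rw [T.swap₁, T.swap₂, T.map_smul, T.swap₂ b c a, T.swap₁ b a c]

theorem map_smul₂ (t : 𝕜) (a b c : H) : T.toFun a (t • b) c = t * T.toFun a b c := by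
  rw [T.swap₁, T.map_smul₁, T.swap₁]

theorem map_add₂ (a b b' c : H) : T.toFun a (b + b') c = T.toFun a b c + T.toFun a b' c := by
  rw [T.swap₂, T.map_add, T.swap₂ a c b, T.swap₂ a c b']

theorem map_add₁ (a a' b c : H) : T.toFun (a + a') b c = T.toFun a b c + T.toFun a' b c := by
  rw [T.swap₁, T.map_add₂, T.swap₁ b a, T.swap₁ b a']

/-- Expansion on the diagonal of the first two arguments. -/
theorem map_add_smul_sq (a b c : H) (t : 𝕜) :
    T.toFun (a + t • b) (a + t • b) c =
      T.toFun a a c + 2 * t * T.toFun a b c + t ^ 2 * T.toFun b b c := by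
  rw [T.map_add₁, T.map_add₂, T.map_add₂, T.map_smul₁, T.map_smul₁, T.map_smul₂, T.map_smul₂,
    T.swap₁ b a]
  ring

theorem eq_mul_inner [CompleteSpace H] {a b c : H} (hc : ‖c‖ = 1)
    (h : ‖T.toFun a b c‖ = ‖a‖ * ‖b‖) (z : H) :
    T.toFun a b z = T.toFun a b c * inner 𝕜 c z := by
  refine eq_mul_inner_of_norm_le
    (⟨⟨T.toFun a b, T.map_add a b⟩, T.map_smul a b⟩ : H →ₗ[𝕜] 𝕜) hc (fun z => ?_) z
  change ‖T.toFun a b z‖ ≤ ‖T.toFun a b c‖ * ‖z‖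
  rw [h]
  exact T.bound a b z

theorem inner_add_inner_swap {a b : H} (ha : ‖a‖ = 1) (hb : ‖b‖ = 1) {t : 𝕜} (ht : ‖t‖ = 1) :
    ((‖a + t • b‖ ^ 2 : ℝ) : 𝕜) = 2 + t * inner 𝕜 a b + starRingEnd 𝕜 t * inner 𝕜 b a := by
  have h1 : inner 𝕜 a a = (1 : 𝕜) := by rw [inner_self_eq_norm_sq_to_K, ha]; simp
  have h2 : inner 𝕜 b b = (1 : 𝕜) := by rw [inner_self_eq_norm_sq_to_K, hb]; simp
  have h3 : starRingEnd 𝕜 t * t = 1 := by rw [RCLike.conj_mul, ht]; simp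
  rw [RCLike.ofReal_pow, ← inner_self_eq_norm_sq_to_K, inner_add_left, inner_add_right,
    inner_add_right, inner_smul_left, inner_smul_right, inner_smul_left, inner_smul_right, h1, h2]
  linear_combination h3

/-- Along a norming triple, the form is norming on the squares of `a + t b`. -/
theorem toFun_add_smul_sq [CompleteSpace H] {a b c : H} (ha : ‖a‖ = 1) (hb : ‖b‖ = 1)
    (hc : ‖c‖ = 1) {ε : 𝕜} (hε : ‖ε‖ = 1) (h : T.toFun a b c = ε) {t : 𝕜} (ht : ‖t‖ = 1) :
    T.toFun (a + t • b) (a + t • b) c = ε * t * ((‖a + t • b‖ ^ 2 : ℝ) : 𝕜) := by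
  -- `T(a,c,·)` attains its norm at `b`, hence is `ε⟪b,·⟫`; likewise `T(b,c,·)` is `ε⟪a,·⟫`.
  have h1 : T.toFun a a c = ε * inner 𝕜 b a := by
    have h' : T.toFun a c b = ε := by rw [T.swap₂, h]
    rw [T.swap₂, T.eq_mul_inner hb (by rw [h', hε, ha, hc, one_mul]), h']
  have h2 : T.toFun b b c = ε * inner 𝕜 a b := by
    have h' : T.toFun b c a = ε := by rw [T.swap₂, T.swap₁, h]
    rw [T.swap₂, T.eq_mul_inner ha (by rw [h', hε, hb, hc, one_mul]), h']
  have h3 : starRingEnd 𝕜 t * t = 1 := by rw [RCLike.conj_mul, ht]; simp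
  rw [T.map_add_smul_sq, h1, h2, h, inner_add_inner_swap ha hb ht]
  linear_combination (-ε * inner 𝕜 b a) * h3

/-- The value of the form at `w` if it is norming at `(u, u, w)`. -/
theorem toFun_diag [CompleteSpace H] {u w : H} (hu : ‖u‖ = 1) (hw : ‖w‖ = 1)
    {ε : 𝕜} (hε : ‖ε‖ = 1) (h : T.toFun u u w = ε) {t : 𝕜} (ht : ‖t‖ = 1) :
    ε + t ^ 2 * T.toFun w w w =
      ε * (t ^ 2 * inner 𝕜 u w ^ 2 + inner 𝕜 w u * inner 𝕜 u w) := by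
  have h3 : starRingEnd 𝕜 t * t = 1 := by rw [RCLike.conj_mul, ht]; simp
  have h' : T.toFun u w u = ε := by rw [T.swap₂, h]
  have hy := T.toFun_add_smul_sq hu hw hu hε h' ht
  -- With `y = u + t w`, `T(y,y,·)` attains its norm at `u`, so it is a multiple of `⟪u,·⟫`;
  -- evaluating at `w` in two ways gives the identity.
  have h1 := T.eq_mul_inner (a := u + t • w) (b := u + t • w) hu (by
    rw [hy, norm_mul, norm_mul, hε, ht, RCLike.norm_ofReal, abs_of_nonneg (sq_nonneg _)]
    ring) w
  have h2 : T.toFun u w w = ε * inner 𝕜 u w := by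
    rw [T.eq_mul_inner hu (by rw [h', hε, hu, hw, one_mul]), h']
  rw [hy, T.map_add_smul_sq, h, h2, inner_add_inner_swap hu hw ht] at h1
  linear_combination h1 + (ε * inner 𝕜 w u * inner 𝕜 u w) * h3

/-- The normalized square of `a + t b` is again norming. -/
theorem toFun_normalized_sq [CompleteSpace H] {a b c : H} (ha : ‖a‖ = 1) (hb : ‖b‖ = 1)
    (hc : ‖c‖ = 1) (h : T.toFun a b c = 1) {t : 𝕜} (ht : ‖t‖ = 1) (hs : a + t • b ≠ 0) :
    T.toFun ((‖a + t • b‖ : 𝕜)⁻¹ • (a + t • b)) ((‖a + t • b‖ : 𝕜)⁻¹ • (a + t • b)) c = t := by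
  have hs' : ((‖a + t • b‖ : ℝ) : 𝕜) ≠ 0 := by simpa using hs
  rw [T.map_smul₁, T.map_smul₂, T.toFun_add_smul_sq ha hb hc norm_one h ht, RCLike.ofReal_pow]
  field_simp

theorem norm_normalize {s : H} (hs : s ≠ 0) : ‖(‖s‖ : 𝕜)⁻¹ • s‖ = 1 := by
  simp [norm_smul, hs]

/-- In the complex case a form is norming at `(u, u, w)` only if `u` and `w` are parallel. -/
theorem mem_span_of_norm_eq_one {H : Type*} [NormedAddCommGroup H] [InnerProductSpace ℂ H]
    [CompleteSpace H] (T : SymmTrilinear ℂ H) {u w : H} (hu : ‖u‖ = 1) (hw : ‖w‖ = 1)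
    (h : ‖T.toFun u u w‖ = 1) : u ∈ Submodule.span ℂ {w} := by
  -- The values `t ^ 2 = 1` and `t ^ 2 = -1` cancel `T(w,w,w)` and `⟪u,w⟫ ^ 2` on addition, leaving
  -- `|⟪u,w⟫| ^ 2 = 1`.
  have h1 := T.toFun_diag hu hw h rfl (t := 1) norm_one
  have h2 := T.toFun_diag hu hw h rfl (t := Complex.I) Complex.norm_I
  rw [Complex.I_sq] at h2
  have h3 : T.toFun u u w * (inner ℂ w u * inner ℂ u w) = T.toFun u u w * 1 := by
    linear_combination -(h1 + h2) / 2
  have h0 : T.toFun u u w ≠ 0 := norm_pos_iff.1 (by rw [h]; exact one_pos)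
  have h4 := congrArg norm (mul_left_cancel₀ h0 h3)
  rw [norm_mul, norm_inner_symm u w, ← sq, norm_one,
    pow_eq_one_iff_of_nonneg (norm_nonneg _) two_ne_zero] at h4
  have hw0 : w ≠ 0 := norm_pos_iff.1 (by rw [hw]; exact one_pos)
  have h5 : ‖inner ℂ w u‖ = ‖w‖ * ‖u‖ := by rw [h4, hu, hw, one_mul]
  have h6 : w = 0 ∨ u ∈ Submodule.span ℂ {w} := ((norm_inner_eq_norm_tfae ℂ w u).out 0 3).1 h5
  exact h6.resolve_left hw0

/-- Both `a + b` and `a - b` are parallel to `c`, hence so are `a` and `b`. -/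
theorem mem_span_singleton_of_eq_one {H : Type*} [NormedAddCommGroup H] [InnerProductSpace ℂ H]
    [CompleteSpace H] (T : SymmTrilinear ℂ H) {a b c : H} (ha : ‖a‖ = 1) (hb : ‖b‖ = 1)
    (hc : ‖c‖ = 1) (h : T.toFun a b c = 1) : b ∈ Submodule.span ℂ {a} := by
  have key : ∀ t : ℂ, ‖t‖ = 1 → ∃ r : ℂ, r • c = a + t • b := by
    intro t ht
    by_cases hs : a + t • b = 0
    · exact ⟨0, by rw [hs, zero_smul]⟩
    · have h1 := mem_span_of_norm_eq_one T (norm_normalize (𝕜 := ℂ) hs) hc (by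
        rw [T.toFun_normalized_sq ha hb hc h ht hs, ht])
      rw [Submodule.smul_mem_iff _ (by simpa using hs)] at h1
      exact Submodule.mem_span_singleton.1 h1
  obtain ⟨p, hp⟩ := key 1 norm_one
  obtain ⟨q, hq⟩ := key (-1) (by simp)
  have h2a : (p + q) • c = (2 : ℂ) • a := by
    rw [add_smul, hp, hq]; module
  have h2b : (p - q) • c = (2 : ℂ) • b := by
    rw [sub_smul, hp, hq]; module
  have hpq : p + q ≠ 0 := by
    intro h0
    rw [h0, zero_smul, eq_comm, smul_eq_zero] at h2a
    rcases h2a with h2 | h2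
    · exact two_ne_zero h2
    · rw [h2, norm_zero] at ha
      exact zero_ne_one ha
  refine Submodule.mem_span_singleton.2 ⟨(p - q) / (p + q), ?_⟩
  have h2 : (2 : ℂ) • (((p - q) / (p + q)) • a) = (2 : ℂ) • b := by
    rw [smul_comm, ← h2a, smul_smul, div_mul_cancel₀ _ hpq, h2b]
  exact smul_right_injective H (two_ne_zero (α := ℂ)) h2

/-- In the real case a form is norming at `(a, b, c)` only if the three vectors are linearly
dependent. -/
theorem mem_span_of_eq_one {H : Type*} [NormedAddCommGroup H] [InnerProductSpace ℝ H]
    [CompleteSpace H] (T : SymmTrilinear ℝ H) {a b c : H} (ha : ‖a‖ = 1) (hb : ‖b‖ = 1)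
    (hc : ‖c‖ = 1) (h : T.toFun a b c = 1) (hab : b ∉ Submodule.span ℝ {a}) :
    c ∈ Submodule.span ℝ {a, b} := by
  have hs : ∀ t : ℝ, ‖t‖ = 1 → a + t • b ≠ 0 := by
    intro t ht h0
    have ht0 : t ≠ 0 := norm_pos_iff.1 (by rw [ht]; exact one_pos)
    refine hab ((Submodule.smul_mem_iff _ ht0).1 ?_)
    rw [eq_neg_of_add_eq_zero_right h0]
    exact neg_mem (Submodule.mem_span_singleton_self a)
  have hm : ∀ t r : ℝ, r • (a + t • b) ∈ Submodule.span ℝ {a, b} := fun t r =>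
    Submodule.smul_mem _ _ (add_mem (Submodule.subset_span (by simp))
      (Submodule.smul_mem _ _ (Submodule.subset_span (by simp))))
  have hn1 : ‖(-1 : ℝ)‖ = 1 := by simp
  have hTu := T.toFun_normalized_sq ha hb hc h norm_one (hs 1 norm_one)
  have hTv := T.toFun_normalized_sq ha hb hc h hn1 (hs (-1) hn1)
  have hu1 := norm_normalize (𝕜 := ℝ) (hs 1 norm_one)
  have hv1 := norm_normalize (𝕜 := ℝ) (hs (-1) hn1)
  have hum := hm 1 ((‖a + (1 : ℝ) • b‖ : ℝ)⁻¹)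
  have hvm := hm (-1) ((‖a + (-1 : ℝ) • b‖ : ℝ)⁻¹)
  have huv : inner ℝ ((‖a + (1 : ℝ) • b‖ : ℝ)⁻¹ • (a + (1 : ℝ) • b))
      ((‖a + (-1 : ℝ) • b‖ : ℝ)⁻¹ • (a + (-1 : ℝ) • b)) = 0 := by
    rw [inner_smul_left, inner_smul_right, one_smul, neg_one_smul, ← sub_eq_add_neg,
      real_inner_add_sub_eq_zero_iff a b |>.2 (by rw [ha, hb]), mul_zero, mul_zero]
  simp only [RCLike.ofReal_real_eq_id, id_eq] at hTu hTv hu1 hv1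
  set u := (‖a + (1 : ℝ) • b‖ : ℝ)⁻¹ • (a + (1 : ℝ) • b)
  set v := (‖a + (-1 : ℝ) • b‖ : ℝ)⁻¹ • (a + (-1 : ℝ) • b)
  have h1 := T.toFun_diag hu1 hc norm_one hTu (t := 1) norm_one
  have h2 := T.toFun_diag hv1 hc hn1 hTv (t := 1) norm_one
  rw [real_inner_comm] at h1 h2
  -- `T` is `1` at `(u,u,c)` and `-1` at `(v,v,c)`; subtracting the two identities eliminates
  -- `T(c,c,c)`.
  have h3 : inner ℝ c u ^ 2 + inner ℝ c v ^ 2 = 1 := by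
    linear_combination -(h1 - h2) / 2
  -- Parseval's equality for the orthonormal pair `u, v`: the unit vector `c` is its own projection
  -- onto their span.
  have h4 : c - (inner ℝ c u • u + inner ℝ c v • v) = 0 := by
    rw [← norm_eq_zero, ← sq_eq_zero_iff, norm_sub_sq_real, norm_add_sq_real, inner_add_right]
    simp only [inner_smul_left, inner_smul_right, norm_smul, huv, hu1, hv1, hc, mul_pow,
      Real.norm_eq_abs, sq_abs]
    linear_combination -h3
  rw [sub_eq_zero.1 h4]
  exact add_mem (Submodule.smul_mem _ _ hum) (Submodule.smul_mem _ _ hvm)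

end SymmTrilinear

/-- The trilinear form obtained from a symmetric multilinear form by fixing all but three of its
arguments to be unit vectors. -/
def SymmTrilinear.ofMultilinear {ι : Type*} [Fintype ι] [DecidableEq ι]
    (f : MultilinearMap 𝕜 (fun _ : ι => H) 𝕜)
    (hsymm : ∀ (x : ι → H) (σ : Equiv.Perm ι), f (x ∘ σ) = f x)
    (hf : ∀ x, ‖f x‖ ≤ ∏ i, ‖x i‖) (x : ι → H) (hx : ∀ i, ‖x i‖ = 1) {i j l : ι}
    (hij : i ≠ j) (hil : i ≠ l) (hjl : j ≠ l) : SymmTrilinear 𝕜 H where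
  toFun a b c := f (Function.update (Function.update (Function.update x i a) j b) l c)
  map_add a b c c' := f.map_update_add _ _ _ _
  map_smul a b t c := f.map_update_smul _ _ _ _
  swap₁ a b c := by
    rw [Function.update_comm hjl, Function.update_comm hil, ← hsymm _ (Equiv.swap i j),
      comp_swap_update_update hij, Function.update_comm hil.symm, Function.update_comm hjl.symm]
  swap₂ a b c := by rw [← hsymm _ (Equiv.swap j l), comp_swap_update_update hjl]
  bound a b c := by
    refine (hf _).trans_eq ?_
    have h : ∀ m, ‖Function.update (Function.update (Function.update x i a) j b) l c m‖ =
        ((if m = i then ‖a‖ else 1) * if m = j then ‖b‖ else 1) * if m = l then ‖c‖ else 1 := by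
      intro m
      simp only [Function.update_apply]
      split_ifs <;> simp_all
    simp only [h, Finset.prod_mul_distrib, Finset.prod_ite_eq', Finset.mem_univ, if_true]

theorem SymmTrilinear.ofMultilinear_self {ι : Type*} [Fintype ι] [DecidableEq ι]
    (f : MultilinearMap 𝕜 (fun _ : ι => H) 𝕜)
    (hsymm : ∀ (x : ι → H) (σ : Equiv.Perm ι), f (x ∘ σ) = f x)
    (hf : ∀ x, ‖f x‖ ≤ ∏ i, ‖x i‖) (x : ι → H) (hx : ∀ i, ‖x i‖ = 1) {i j l : ι}
    (hij : i ≠ j) (hil : i ≠ l) (hjl : j ≠ l) :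
    (ofMultilinear f hsymm hf x hx hij hil hjl).toFun (x i) (x j) (x l) = f x := by
  simp [ofMultilinear]

/-- If `π_s(x₁ ∨ ⋯ ∨ xₖ) = 1`, any three of the vectors admit a norming symmetric trilinear form. -/
theorem exists_symmTrilinear {k : ℕ} {x : Fin k → H} (hx : ∀ i, ‖x i‖ = 1)
    (h : symProjNorm (symProd 𝕜 x) = 1) {i j l : Fin k} (hij : i ≠ j) (hil : i ≠ l)
    (hjl : j ≠ l) : ∃ T : SymmTrilinear 𝕜 H, T.toFun (x i) (x j) (x l) = 1 := by
  obtain ⟨ξ, hξ, hbound⟩ := exists_norming_form (Nat.ne_zero_of_lt i.2) (symProd 𝕜 x)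
  refine ⟨.ofMultilinear (symForm ξ) (symForm_comp_perm ξ) hbound x hx hij hil hjl, ?_⟩
  rw [SymmTrilinear.ofMultilinear_self, symForm_apply, hξ, h, RCLike.ofReal_one]

end Trilinear

end SymTensor

end

/-! ### The complex and real characterizations -/

namespace SymTensor

theorem symProjNorm_symProd_eq_one_iff_complex {k : ℕ} (hk : 3 ≤ k) {H : Type*}
    [NormedAddCommGroup H] [InnerProductSpace ℂ H] [CompleteSpace H] {x : Fin k → H}
    (hx : ∀ i, ‖x i‖ = 1) :
    symProjNorm (symProd ℂ x) = 1 ↔ Module.finrank ℂ (Submodule.span ℂ (Set.range x)) = 1 := by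
  let i₀ : Fin k := ⟨0, by omega⟩
  have h0 : x i₀ ≠ 0 := norm_pos_iff.1 (by rw [hx]; exact one_pos)
  constructor
  · intro h
    have hspan : Submodule.span ℂ (Set.range x) = Submodule.span ℂ {x i₀} := by
      refine le_antisymm (Submodule.span_le.2 ?_) (Submodule.span_mono (by simp))
      rintro _ ⟨j, rfl⟩
      rcases eq_or_ne i₀ j with rfl | hij
      · exact Submodule.mem_span_singleton_self _
      -- Here `k ≥ 3` supplies the third slot of the trilinear form.
      · obtain ⟨l, hl⟩ := Finset.exists_mem_notMem_of_card_lt_card (s := {i₀, j})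
          (t := (Finset.univ : Finset (Fin k))) (by
            rw [Finset.card_univ, Fintype.card_fin]
            exact lt_of_le_of_lt Finset.card_le_two hk)
        simp only [Finset.mem_insert, Finset.mem_singleton, not_or] at hl
        obtain ⟨T, hT⟩ := exists_symmTrilinear hx h hij (Ne.symm hl.2.1) (Ne.symm hl.2.2)
        exact T.mem_span_singleton_of_eq_one (hx _) (hx _) (hx _) hT
    rw [hspan, finrank_span_singleton h0]
  · intro h
    refine symProjNorm_symProd_eq_one (by omega) (innerSL ℂ (x i₀)).toLinearMap (fun y => ?_) hx
      fun i => ?_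
    · simpa [hx] using norm_inner_le_norm (𝕜 := ℂ) (x i₀) y
    · obtain ⟨c, hc⟩ := (finrank_eq_one_iff_of_nonzero' (K := ℂ)
        (⟨x i₀, Submodule.subset_span ⟨i₀, rfl⟩⟩ : Submodule.span ℂ (Set.range x))
        (by simpa using h0)).1 h ⟨x i, Submodule.subset_span ⟨i, rfl⟩⟩
      have hc' : c • x i₀ = x i := congrArg Subtype.val hc
      have hi := hx i
      rw [← hc', norm_smul, hx, mul_one] at hi
      simp [← hc', hx, hi]

theorem symProjNorm_symProd_eq_one_iff_real {k : ℕ} (hk : 3 ≤ k) {H : Type*}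
    [NormedAddCommGroup H] [InnerProductSpace ℝ H] [CompleteSpace H] {x : Fin k → H}
    (hx : ∀ i, ‖x i‖ = 1) :
    symProjNorm (symProd ℝ x) = 1 ↔ (Module.finrank ℝ (Submodule.span ℝ (Set.range x)) = 1 ∨
      Module.finrank ℝ (Submodule.span ℝ (Set.range x)) = 2) := by
  let i₀ : Fin k := ⟨0, by omega⟩
  have h0 : x i₀ ≠ 0 := norm_pos_iff.1 (by rw [hx]; exact one_pos)
  have hmem : ∀ i, x i ∈ Submodule.span ℝ (Set.range x) := fun i => Submodule.subset_span ⟨i, rfl⟩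
  constructor
  · intro h
    by_cases hall : ∀ j, x j ∈ Submodule.span ℝ {x i₀}
    · left
      have hspan : Submodule.span ℝ (Set.range x) = Submodule.span ℝ {x i₀} := by
        refine le_antisymm (Submodule.span_le.2 ?_) (Submodule.span_mono (by simp))
        rintro _ ⟨j, rfl⟩
        exact hall j
      rw [hspan, finrank_span_singleton h0]
    · right
      push Not at hall
      obtain ⟨j, hj⟩ := hall
      have hij : i₀ ≠ j := by
        rintro rfl
        exact hj (Submodule.mem_span_singleton_self _)
      have hspan : Submodule.span ℝ (Set.range x) = Submodule.span ℝ (Set.range ![x i₀, x j]) := by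
        rw [Matrix.range_cons, Matrix.range_cons, Matrix.range_empty, Set.union_empty,
          Set.singleton_union]
        refine le_antisymm (Submodule.span_le.2 ?_) (Submodule.span_mono ?_)
        · rintro _ ⟨l, rfl⟩
          rcases eq_or_ne i₀ l with rfl | hil
          · exact Submodule.subset_span (by simp)
          rcases eq_or_ne j l with rfl | hjl
          · exact Submodule.subset_span (by simp)
          obtain ⟨T, hT⟩ := exists_symmTrilinear hx h hij hil hjl
          exact T.mem_span_of_eq_one (hx _) (hx _) (hx _) hT hj
        · rintro _ (rfl | rfl) <;> simp
      have hli : LinearIndependent ℝ ![x i₀, x j] := by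
        rw [LinearIndependent.pair_iff' h0]
        intro a ha
        exact hj (Submodule.mem_span_singleton.2 ⟨a, ha⟩)
      rw [hspan, finrank_span_eq_card hli, Fintype.card_fin]
  · rintro (h | h)
    · refine symProjNorm_symProd_eq_one (by omega) (innerSL ℝ (x i₀)).toLinearMap (fun y => ?_) hx
        fun i => ?_
      · simpa [hx] using norm_inner_le_norm (𝕜 := ℝ) (x i₀) y
      · obtain ⟨c, hc⟩ := (finrank_eq_one_iff_of_nonzero' (K := ℝ)
          (⟨x i₀, hmem i₀⟩ : Submodule.span ℝ (Set.range x))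
          (by simpa using h0)).1 h ⟨x i, hmem i⟩
        have hc' : c • x i₀ = x i := congrArg Subtype.val hc
        have hi := hx i
        rw [← hc', norm_smul, hx, mul_one] at hi
        simp [← hc', hx, hi]
    · let V := Submodule.span ℝ (Set.range x)
      have : FiniteDimensional ℝ V := FiniteDimensional.span_of_finite ℝ (Set.finite_range x)
      -- The plane is identified with `ℂ` for its multiplicative norm: the product of the
      -- projections of the arguments is a contractive symmetric form of modulus 1 at `x`.
      let e : V ≃ₗᵢ[ℝ] ℂ :=
        ((stdOrthonormalBasis ℝ V).reindex (finCongr h)).repr.trans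
          Complex.orthonormalBasisOneI.repr.symm
      refine symProjNorm_symProd_eq_one (by omega)
        (e.toLinearEquiv.toLinearMap ∘ₗ V.orthogonalProjectionOnto.toLinearMap) (fun y => ?_) hx
        fun i => ?_
      · change ‖e (V.orthogonalProjectionOnto y)‖ ≤ ‖y‖
        rw [e.norm_map]
        exact V.norm_orthogonalProjectionOnto_apply_le y
      · change ‖e (V.orthogonalProjectionOnto (x i))‖ = 1
        rw [e.norm_map, Submodule.orthogonalProjectionOnto_mem_subspace_eq_self (⟨x i, hmem i⟩ : V)]
        exact hx i

end SymTensor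

theorem proposition1p1 (k : ℕ) (hk : 3 ≤ k) :
    (∀ (H : Type*) [NormedAddCommGroup H] [InnerProductSpace ℂ H] [CompleteSpace H]
        (x : Fin k → H), (∀ i, ‖x i‖ = 1) →
        (SymTensor.symProjNorm (SymTensor.symProd ℂ x) = 1 ↔
          Module.finrank ℂ (Submodule.span ℂ (Set.range x)) = 1)) ∧
    (∀ (H : Type*) [NormedAddCommGroup H] [InnerProductSpace ℝ H] [CompleteSpace H]
        (x : Fin k → H), (∀ i, ‖x i‖ = 1) →
        (SymTensor.symProjNorm (SymTensor.symProd ℝ x) = 1 ↔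
          (Module.finrank ℝ (Submodule.span ℝ (Set.range x)) = 1 ∨
            Module.finrank ℝ (Submodule.span ℝ (Set.range x)) = 2))) :=
  ⟨fun _ _ _ _ _ hx => SymTensor.symProjNorm_symProd_eq_one_iff_complex hk hx,
    fun _ _ _ _ _ hx => SymTensor.symProjNorm_symProd_eq_one_iff_real hk hx⟩
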